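/- Conventions. Let $Lb$ be a set of labels and $At\subseteq Lb$ a set of atoms. Terms over $Lb$ are built from labels by arbitrary (possibly empty or infinite) products $\prod$ and sums $\sum$ and by a binary application "$\cdot$"; $1$ is the empty product, $0$ the empty sum. Causal values are the equivalence classes of terms under the axioms of a completely distributive complete lattice with meet $*$ and join $+$ together with: associativity $t\cdot(u\cdot w)=(t\cdot u)\cdot w$; absorption $t=t+u\cdot t\cdot w$ and $u\cdot t\cdot w=t*(u\cdot t\cdot w)$; $1\cdot t=t=t\cdot 1$; $0\cdot t=0=t\cdot 0$; $l\cdot l=l$ for labels $l$; distributivity of $\cdot$ on both sides over arbitrary sums; and, for sum-free terms, $c\cdot d\cdot e=(c\cdot d)*(d\cdot e)$ if $d\neq 1$, and distributivity of $\cdot$ on both sides over nonempty products. A causal graph is a set $G\subseteq Lb\times Lb$ of edges that is transitive and contains $(v,v)$ and $(w,w)$ whenever it contains $(v,w)$; it is identified with the value $\prod_{(v,w)\in G}v\cdot w$. A normal program $P$ is a (possibly infinite) set of rules $r: A\leftarrow B_1,\dots,B_m,\mathrm{not}\,B_{m+1},\dots,\mathrm{not}\,B_n$ with $r\in Lb$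 and $A,B_j\in At$. An interpretation $I$ maps atoms to causal values, ordered pointwise by $\le$; $I^{st}(A)=0$ if $I(A)=0$ and $I^{st}(A)=1$ otherwise. The reduct $P^I$ is obtained from $P$ by removing each rule with $I(B_j)\neq0$ for some $j>m$, and then removing all negative literals from the other rules. - $I$ is a model of a positive normal program $Q$ if $(I(B_1)*\dots*I(B_m))\cdot r\cdot A\le I(A)$ for each rule of $Q$. Write $J\sqsubseteq I$ if $J\le I$ or $\{A: J(A)\ne0\}\subsetneq\{A: I(A)\ne0\}$. $I$ is a causal stable model of $P$ if $I$ is a model of $P^I$ and no model $J\neq I$ of $P^I$ has $J\sqsubseteq I$. - $J$ is a CJ-model of $Q$ if $(J(B_1)*\dots*J(B_m))\cdot r\le J(A)$ for each rule of $Q$. $J$ is a CJ-stable model of $P$ if $J$ is the $\le$-least CJ-model of $P^J$. **Theorem.** Let $P$ be a normal program. 1. For every causal stable model $I$ of $P$ there is a unique CJ-stable model $J$ of $P$ with $I^{st}=J^{st}$, and for every CJ-stable model $J$ of $P$ there is a unique causal stable model $I$ of $P$ with $I^{st}=J^{st}$. 2. Let $I$ be a causal stable model and $J$ a CJ-stable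 model of $P$ with $I^{st}=J^{st}$. Let $A\in At$ and let $G$ be a causal graph with $G\le I(A)$. (a) If no rule of $P$ is labelled by an atom, then $G'\le J(A)$, where $G'$ is the causal graph obtained from $G$ by deleting every edge that contains an atom label. (b) In general (some rules of $P$, such as facts $A:A\leftarrow$, may be labelled by atoms), $G'\le J(A)$, where $G'$ is obtained from $G$ by deleting every edge that contains an atom label which is not the label of a rule of $P$. -/

import Mathlib

universe u

namespace CausalLP

/-! ### Causal terms and causal values -/

/-- Causal terms over a set of labels. A product or sum of a (possibly empty, possibly infinite) set
of terms is written as the product or sum of a family of terms. -/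
inductive Term (L : Type u) : Type (u + 1)
  | label (l : L) : Term L
  | prod {ι : Type u} (f : ι → Term L) : Term L
  | sum {ι : Type u} (f : ι → Term L) : Term L
  | app (t s : Term L) : Term L

namespace Term

variable {L : Type u}

/-- The term `1`: the empty product. -/
def one : Term L := prod (fun i : PEmpty.{u + 1} => i.elim)

/-- The term `0`: the empty sum. -/
def zero : Term L := sum (fun i : PEmpty.{u + 1} => i.elim)

/-- The binary product `t * s`. -/
def mul (t s : Term L) : Term L := prod (fun b : ULift.{u} Bool => cond b.down t s)

/-- The binary sum `t + s`. -/
def add (t s : Term L) : Term L := sum (fun b : ULift.{u} Bool => cond b.down t s)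

/-- The term is built without addition. -/
def SumFree : Term L → Prop
  | label _ => True
  | prod f => ∀ i, SumFree (f i)
  | sum _ => False
  | app t s => SumFree t ∧ SumFree s

/-- Some label occurs in the term. -/
def HasLabel : Term L → Prop
  | label _ => True
  | prod f => ∃ i, HasLabel (f i)
  | sum f => ∃ i, HasLabel (f i)
  | app t s => HasLabel t ∨ HasLabel s

/-- The equations for application. In the three equations of product distributivity the terms
`c`, `d`, `e` are without addition. The side condition `d ≠ 1` of `prod_distrib` is about values;
for a term `d` without addition it says that a label occurs in `d`. Distributivity over products is
for nonempty products only (`c · 1 = c`), distributivity over sums is for all sums. -/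
inductive Law : Term L → Term L → Prop
  | assoc (t s w : Term L) : Law (app t (app s w)) (app (app t s) w)
  | absorb_add (t s w : Term L) : Law t (add t (app (app s t) w))
  | absorb_mul (t s w : Term L) : Law (app (app s t) w) (mul t (app (app s t) w))
  | one_app (t : Term L) : Law t (app one t)
  | app_one (t : Term L) : Law t (app t one)
  | app_zero (t : Term L) : Law zero (app t zero)
  | zero_app (t : Term L) : Law zero (app zero t)
  | idem (l : L) : Law (app (label l) (label l)) (label l)
  | app_sum (t : Term L) {ι : Type u} (f : ι → Term L) :
      Law (app t (sum f)) (sum fun i => app t (f i))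
  | sum_app {ι : Type u} (f : ι → Term L) (t : Term L) :
      Law (app (sum f) t) (sum fun i => app (f i) t)
  | prod_distrib (c d e : Term L) : SumFree c → SumFree d → SumFree e → HasLabel d →
      Law (app (app c d) e) (mul (app c d) (app d e))
  | app_prod (c : Term L) {ι : Type u} [Nonempty ι] (f : ι → Term L) :
      SumFree c → (∀ i, SumFree (f i)) → Law (app c (prod f)) (prod fun i => app c (f i))
  | prod_app {ι : Type u} [Nonempty ι] (f : ι → Term L) (c : Term L) :
      (∀ i, SumFree (f i)) → SumFree c → Law (app (prod f) c) (prod fun i => app (f i) c)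

/-- Derivable inequalities between terms: the least preorder for which products are greatest lower
bounds, sums are least upper bounds, products distribute over sums (complete distributivity),
application is monotone, and both sides of each `Law` are equivalent. -/
inductive Le : Term L → Term L → Prop
  | refl (t : Term L) : Le t t
  | trans {t s w : Term L} : Le t s → Le s w → Le t w
  | prod_le {ι : Type u} (f : ι → Term L) (i : ι) : Le (prod f) (f i)
  | le_prod {ι : Type u} (f : ι → Term L) (t : Term L) : (∀ i, Le t (f i)) → Le t (prod f)
  | le_sum {ι : Type u} (f : ι → Term L) (i : ι) : Le (f i) (sum f)
  | sum_le {ι : Type u} (f : ι → Term L) (t : Term L) : (∀ i, Le (f i) t) → Le (sum f) t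
  | distrib {ι : Type u} {κ : ι → Type u} (f : ∀ i, κ i → Term L) :
      Le (prod fun i => sum (f i)) (sum fun g : (∀ i, κ i) => prod fun i => f i (g i))
  | app_mono {t t' s s' : Term L} : Le t t' → Le s s' → Le (app t s) (app t' s')
  | law {t s : Term L} : Law t s → Le t s
  | law_symm {t s : Term L} : Law t s → Le s t

instance : Preorder (Term L) where
  le := Le
  le_refl := Le.refl
  le_trans _ _ _ := Le.trans

theorem mul_le_left (t s : Term L) : mul t s ≤ t :=
  Le.prod_le (fun b : ULift.{u} Bool => cond b.down t s) ⟨true⟩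

theorem mul_le_right (t s : Term L) : mul t s ≤ s :=
  Le.prod_le (fun b : ULift.{u} Bool => cond b.down t s) ⟨false⟩

theorem le_mul {w t s : Term L} (h₁ : w ≤ t) (h₂ : w ≤ s) : w ≤ mul t s :=
  Le.le_prod _ _ (by rintro ⟨_ | _⟩ <;> assumption)

end Term

/-- Causal values: equivalence classes of terms, ordered by the lattice order. -/
abbrev Value (L : Type u) : Type (u + 1) := Antisymmetrization (Term L) (· ≤ ·)

namespace Value

variable {L : Type u}

/-- The value represented by a term. -/
def mk (t : Term L) : Value L := toAntisymmetrization (· ≤ ·) t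

/-- The product `x * y` of values is their infimum `x ⊓ y`. -/
instance : SemilatticeInf (Value L) where
  inf := Quotient.map₂ Term.mul (fun _ _ h _ _ k =>
    ⟨Term.le_mul ((Term.mul_le_left _ _).trans h.1) ((Term.mul_le_right _ _).trans k.1),
      Term.le_mul ((Term.mul_le_left _ _).trans h.2) ((Term.mul_le_right _ _).trans k.2)⟩)
  inf_le_left x y := Quotient.inductionOn₂ x y fun t s => Term.mul_le_left t s
  inf_le_right x y := Quotient.inductionOn₂ x y fun t s => Term.mul_le_right t s
  le_inf x y z := Quotient.inductionOn₃ x y z fun _ _ _ h k => Term.le_mul h k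

/-- The value `1`, written `⊤`. -/
instance : OrderTop (Value L) where
  top := mk Term.one
  le_top x := Quotient.inductionOn x fun _ => Term.Le.le_prod _ _ (fun i => i.elim)

/-- The value `0`, written `⊥`. -/
instance : OrderBot (Value L) where
  bot := mk Term.zero
  bot_le x := Quotient.inductionOn x fun _ => Term.Le.sum_le _ _ (fun i => i.elim)

/-- Application `x · y` of values. -/
def app : Value L → Value L → Value L :=
  Quotient.map₂ Term.app
    (fun _ _ h _ _ k => ⟨Term.Le.app_mono h.1 k.1, Term.Le.app_mono h.2 k.2⟩)

/-- The value of a label. -/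
def label (l : L) : Value L := mk (Term.label l)

end Value

/-! ### Causal graphs -/

/-- A causal graph: a set of edges that is transitively and reflexively closed (reflexivity is
required at the endpoints of edges; the vertices are the `v` with `(v, v)` an edge). -/
structure CGraph (L : Type u) where
  edges : Set (L × L)
  refl_left : ∀ {v w : L}, (v, w) ∈ edges → (v, v) ∈ edges
  refl_right : ∀ {v w : L}, (v, w) ∈ edges → (w, w) ∈ edges
  trans : ∀ {v w z : L}, (v, w) ∈ edges → (w, z) ∈ edges → (v, z) ∈ edges

namespace CGraph

variable {L : Type u}

/-- The individual cause given by a causal graph: the product of `v · w` over all edges `(v, w)`. -/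
def value (G : CGraph L) : Value L :=
  Value.mk (Term.prod fun e : G.edges => Term.app (Term.label e.1.1) (Term.label e.1.2))

/-- Delete every edge that contains a label from `D`. -/
def deleteLabels (D : Set L) (G : CGraph L) : CGraph L where
  edges := {e | e ∈ G.edges ∧ e.1 ∉ D ∧ e.2 ∉ D}
  refl_left h := ⟨G.refl_left h.1, h.2.1, h.2.1⟩
  refl_right h := ⟨G.refl_right h.1, h.2.2, h.2.2⟩
  trans h k := ⟨G.trans h.1 k.1, h.2.1, k.2.2⟩

end CGraph

/-! ### Programs. The atoms form a set `At` of labels. -/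

/-- A rule
`label : ⋁ headPos ∨ ⋁ not headNeg ← bodyPos, not bodyNeg`. -/
structure Rule {L : Type u} (At : Set L) where
  label : L
  headPos : Finset At
  headNeg : Finset At
  bodyPos : Finset At
  bodyNeg : Finset At

/-- A program is a set of rules. -/
abbrev Program {L : Type u} (At : Set L) := Set (Rule At)

/-- An interpretation assigns a causal value to each atom; interpretations are ordered pointwise. -/
abbrev Interp {L : Type u} (At : Set L) := At → Value L

variable {L : Type u} {At : Set L}

/-- The head consists of a single positive literal. -/
def Rule.IsNormal (R : Rule At) : Prop := (∃ A, R.headPos = {A}) ∧ R.headNeg = ∅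

/-- All rules are normal. -/
def Program.IsNormal (P : Program At) : Prop := ∀ R ∈ P, R.IsNormal

namespace Interp

open Classical in
/-- The value of the literal `not A`. -/
noncomputable def neg (I : Interp At) (A : At) : Value L := if I A = ⊥ then ⊤ else ⊥

open Classical in
/-- The standard (two-valued) interpretation that corresponds to `I`. -/
noncomputable def std (I : Interp At) : Interp At := fun A => if I A = ⊥ then ⊥ else ⊤

/-- The true atoms. -/
def atoms (I : Interp At) : Set At := {A | I A ≠ ⊥}

/-- The weaker relation `I ⊑ J`: `I ≤ J`, or the true atoms of `I` are strictly among those of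
`J`. -/
def WLe (I J : Interp At) : Prop := I ≤ J ∨ I.atoms ⊂ J.atoms

/-- The value of the body of a rule. -/
noncomputable def body (I : Interp At) (R : Rule At) : Value L :=
  R.bodyPos.inf I ⊓ R.bodyNeg.inf I.neg

/-- `I` satisfies `R`: `body · label · A ≤ I(A)` for some atom `A` in the head. -/
def Satisfies (I : Interp At) (R : Rule At) : Prop :=
  ∃ A ∈ R.headPos,
    Value.app (Value.app (I.body R) (Value.label R.label)) (Value.label (A : L)) ≤ I A

/-- `I` is a model of `P`. -/
def IsModel (I : Interp At) (P : Program At) : Prop := ∀ R ∈ P, I.Satisfies R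

/-- `I` satisfies the normal rule `R` in the sense of causal graph justifications (CJ):
`body · label ≤ I(A)` for the head atom `A`. The label of the head atom is not appended. -/
def CJSatisfies (I : Interp At) (R : Rule At) : Prop :=
  ∀ A ∈ R.headPos, Value.app (I.body R) (Value.label R.label) ≤ I A

/-- `I` is a CJ-model of the normal program `P`. -/
def IsCJModel (I : Interp At) (P : Program At) : Prop := ∀ R ∈ P, I.CJSatisfies R

end Interp

/-- The rule without its negative literals. -/
def Rule.positivePart (R : Rule At) : Rule At where
  label := R.label
  headPos := R.headPos
  headNeg := ∅
  bodyPos := R.bodyPos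
  bodyNeg := ∅

/-- The reduct `P^I`: remove the rules with `I(B) ≠ 0` for some `B` in the negative body and those
with `I(B) = 0` for some `B` in the negative head, and the negative literals of the other rules. -/
def Program.reduct (P : Program At) (I : Interp At) : Program At :=
  {R' | ∃ R ∈ P, (∀ B ∈ R.bodyNeg, I B = ⊥) ∧ (∀ B ∈ R.headNeg, I B ≠ ⊥) ∧
    R' = R.positivePart}

/-- Causal stable models: `I` is a `⊑`-minimal model of the positive program `P^I`. -/
def IsCausalStable (P : Program At) (I : Interp At) : Prop :=
  I.IsModel (P.reduct I) ∧
    ¬ ∃ J : Interp At, J.IsModel (P.reduct I) ∧ Interp.WLe J I ∧ J ≠ I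

/-- CJ-stable models of a normal program: `J` is the `≤`-least CJ-model of `P^J`. -/
def IsCJStable (P : Program At) (J : Interp At) : Prop :=
  IsLeast {K : Interp At | K.IsCJModel (P.reduct J)} J

end CausalLP

/-! A causal value is determined by the causal graphs below it. Forcing computes these sets by
recursion on terms. It is sound: every axiom preserves it (`Forces.of_le`). It is complete: a graph
that forces a term lies below it, and every term lies below the sum of the graphs forcing it
(`le_sumTerm_forces`). Hence the order on values is inclusion of sets of graphs
(`le_iff_forall_value`), and `value_le_app` describes application by joining two graphs.

Both immediate-consequence conditions are monotone on a positive program, so least models of either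
kind exist, and causal stability means being the least model of the reduct. Application of nonzero
values is nonzero, so replacing every nonzero value by `1` turns CJ-models into models and
conversely. The two least models therefore have the same true atoms; these determine the reduct,
which gives the correspondence.

For the second part, deleting labels commutes well enough with joining graphs: as long as rule
labels are kept, the graphs whose deletion lies below `J A` form a model
(`IsCJModel.undelete_isModel`), and the least model `I` is below it. -/

namespace CausalLP

namespace CGraph

variable {L : Type u}

/-! ### Graphs forcing terms -/

/-- The vertices of a causal graph. -/
def verts (G : CGraph L) : Set L := {v | (v, v) ∈ G.edges}

/-- The subgraph induced on a set of labels. -/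
def restrict (G : CGraph L) (S : Set L) : CGraph L where
  edges := {e | e ∈ G.edges ∧ e.1 ∈ S ∧ e.2 ∈ S}
  refl_left h := ⟨G.refl_left h.1, h.2.1, h.2.1⟩
  refl_right h := ⟨G.refl_right h.1, h.2.2, h.2.2⟩
  trans h k := ⟨G.trans h.1 k.1, h.2.1, k.2.2⟩

theorem restrict_subset (G : CGraph L) (S : Set L) : (G.restrict S).edges ⊆ G.edges :=
  fun _ h => h.1

theorem subset_restrict {G H : CGraph L} {S : Set L} (h : H.edges ⊆ G.edges) (hS : H.verts ⊆ S) :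
    H.edges ⊆ (G.restrict S).edges :=
  fun _ he => ⟨h he, hS (H.refl_left he), hS (H.refl_right he)⟩

/-- The intersection of a family of causal graphs. -/
def inter {κ : Sort*} (G : κ → CGraph L) : CGraph L where
  edges := {e | ∀ k, e ∈ (G k).edges}
  refl_left h k := (G k).refl_left (h k)
  refl_right h k := (G k).refl_right (h k)
  trans h h' k := (G k).trans (h k) (h' k)

/-- The graph without edges. -/
def empty : CGraph L where
  edges := ∅
  refl_left h := h.elim
  refl_right h := h.elim
  trans h := h.elim

/-- The graph with all edges. -/
def full : CGraph L where
  edges := Set.univ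
  refl_left _ := trivial
  refl_right _ := trivial
  trans _ _ := trivial

/-- `G.Forces t` says that the individual cause `G` lies below `t`. -/
def Forces : CGraph L → Term L → Prop
  | G, .label l => (l, l) ∈ G.edges
  | G, .prod f => ∀ i, Forces G (f i)
  | G, .sum f => ∃ i, Forces G (f i)
  | G, .app t s => ∃ G₁ G₂ : CGraph L, Forces G₁ t ∧ Forces G₂ s ∧ G₁.edges ⊆ G.edges ∧
      G₂.edges ⊆ G.edges ∧ ∀ v ∈ G₁.verts, ∀ w ∈ G₂.verts, (v, w) ∈ G.edges

theorem Forces.mono {t : Term L} {G H : CGraph L} (h : G.Forces t) (hGH : G.edges ⊆ H.edges) :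
    H.Forces t := by
  induction t generalizing G H with
  | label l => exact hGH h
  | prod f ih => exact fun i => ih i (h i) hGH
  | sum f ih => obtain ⟨i, hi⟩ := h; exact ⟨i, ih i hi hGH⟩
  | app t s _ _ =>
    obtain ⟨G₁, G₂, h₁, h₂, k₁, k₂, k⟩ := h
    exact ⟨G₁, G₂, h₁, h₂, k₁.trans hGH, k₂.trans hGH, fun v hv w hw => hGH (k v hv w hw)⟩

theorem forces_one (G : CGraph L) : G.Forces Term.one := fun i => i.elim

theorem not_forces_zero (G : CGraph L) : ¬ G.Forces Term.zero := fun ⟨i, _⟩ => i.elim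

theorem forces_mul {G : CGraph L} {t s : Term L} :
    G.Forces (Term.mul t s) ↔ G.Forces t ∧ G.Forces s :=
  ⟨fun h => ⟨h ⟨true⟩, h ⟨false⟩⟩, fun h => by rintro ⟨_ | _⟩; exacts [h.2, h.1]⟩

theorem forces_add {G : CGraph L} {t s : Term L} :
    G.Forces (Term.add t s) ↔ G.Forces t ∨ G.Forces s := by
  constructor
  · rintro ⟨⟨_ | _⟩, h⟩
    exacts [Or.inr h, Or.inl h]
  · rintro (h | h)
    exacts [⟨⟨true⟩, h⟩, ⟨⟨false⟩, h⟩]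

theorem Forces.of_app_left {G : CGraph L} {t s : Term L} (h : G.Forces (.app t s)) :
    G.Forces t := by
  obtain ⟨G₁, G₂, h₁, h₂, k₁, k₂, k⟩ := h
  exact h₁.mono k₁

theorem Forces.of_app_right {G : CGraph L} {t s : Term L} (h : G.Forces (.app t s)) :
    G.Forces s := by
  obtain ⟨G₁, G₂, h₁, h₂, k₁, k₂, k⟩ := h
  exact h₂.mono k₂

/-- Without sums there is no choice of summand, so witnesses for the individual graphs can be
intersected. This is where the sum-free side conditions of the laws are used. -/
theorem forces_inter {t : Term L} (ht : t.SumFree) {κ : Type*} (G : κ → CGraph L) [Nonempty κ]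
    (h : ∀ k, (G k).Forces t) : (inter G).Forces t := by
  induction t generalizing G with
  | label l => exact h
  | prod f ih => exact fun i => ih i (ht i) G fun k => h k i
  | sum f _ => exact ht.elim
  | app t s iht ihs =>
    choose G₁ G₂ h₁ h₂ k₁ k₂ k using h
    refine ⟨inter G₁, inter G₂, iht ht.1 G₁ h₁, ihs ht.2 G₂ h₂, fun e he i => k₁ i (he i),
      fun e he i => k₂ i (he i), fun v hv w hw i => k i v (hv i) w (hw i)⟩

theorem Forces.verts_nonempty {t : Term L} (ht : t.SumFree) (hl : t.HasLabel) {G : CGraph L}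
    (h : G.Forces t) : G.verts.Nonempty := by
  induction t generalizing G with
  | label l => exact ⟨l, h⟩
  | prod f ih => obtain ⟨i, hi⟩ := hl; exact ih i (ht i) hi (h i)
  | sum f _ => exact ht.elim
  | app t s iht ihs =>
    exact hl.elim (fun hl => iht ht.1 hl h.of_app_left) (fun hl => ihs ht.2 hl h.of_app_right)

/-- If `G` contains the edges that an application of `G₁` to `G₂` adds, then so does its subgraph
on the vertices of `G₁` and `G₂`. -/
theorem Forces.app_restrict {G G₁ G₂ : CGraph L} {t s : Term L} (h₁ : G₁.Forces t)
    (h₂ : G₂.Forces s) (k₁ : G₁.edges ⊆ G.edges) (k₂ : G₂.edges ⊆ G.edges)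
    (k : ∀ v ∈ G₁.verts, ∀ w ∈ G₂.verts, (v, w) ∈ G.edges) :
    (G.restrict (G₁.verts ∪ G₂.verts)).Forces (.app t s) :=
  ⟨G₁, G₂, h₁, h₂, subset_restrict k₁ Set.subset_union_left,
    subset_restrict k₂ Set.subset_union_right,
    fun v hv w hw => ⟨k v hv w hw, Or.inl hv, Or.inr hw⟩⟩

theorem forces_app_assoc {G : CGraph L} {t s w : Term L} :
    G.Forces (.app t (.app s w)) ↔ G.Forces (.app (.app t s) w) := by
  constructor
  · rintro ⟨G₁, G', h₁, ⟨G₂, G₃, h₂, h₃, l₂, l₃, l⟩, k₁, k', k⟩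
    refine ⟨_, G₃, h₁.app_restrict h₂ k₁ (l₂.trans k') fun v hv w hw => k v hv w (l₂ hw), h₃,
      restrict_subset _ _, l₃.trans k', ?_⟩
    rintro v ⟨_, hv | hv, _⟩ w hw
    exacts [k v hv w (l₃ hw), k' (l v hv w hw)]
  · rintro ⟨G', G₃, ⟨G₁, G₂, h₁, h₂, l₁, l₂, l⟩, h₃, k', k₃, k⟩
    refine ⟨G₁, _, h₁, h₂.app_restrict h₃ (l₂.trans k') k₃ fun v hv w hw => k v (l₂ hv) w hw,
      l₁.trans k', restrict_subset _ _, ?_⟩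
    rintro v hv w ⟨_, hw | hw, _⟩
    exacts [k' (l v hv w hw), k v (l₁ hv) w hw]

theorem forces_iff_of_law {t s : Term L} (h : Term.Law t s) (G : CGraph L) :
    G.Forces t ↔ G.Forces s := by
  cases h with
  | assoc t s w => exact forces_app_assoc
  | absorb_add _ s w =>
    rw [forces_add]
    exact ⟨Or.inl, fun h => h.elim id fun h => h.of_app_left.of_app_right⟩
  | absorb_mul t s w =>
    rw [forces_mul]
    exact ⟨fun h => ⟨h.of_app_left.of_app_right, h⟩, fun h => h.2⟩
  | one_app =>
    exact ⟨fun h => ⟨empty, G, forces_one _, h, Set.empty_subset _, subset_rfl,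
      fun v hv => hv.elim⟩, Forces.of_app_right⟩
  | app_one =>
    exact ⟨fun h => ⟨G, empty, h, forces_one _, subset_rfl, Set.empty_subset _,
      fun v _ w hw => hw.elim⟩, Forces.of_app_left⟩
  | app_zero t =>
    exact ⟨fun h => (not_forces_zero _ h).elim, fun h => (not_forces_zero _ h.of_app_right).elim⟩
  | zero_app t =>
    exact ⟨fun h => (not_forces_zero _ h).elim, fun h => (not_forces_zero _ h.of_app_left).elim⟩
  | idem l =>
    refine ⟨Forces.of_app_left, fun h => ?_⟩
    -- Restricting to the single vertex `l` ensures that joining the two copies requires only the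
    -- edge `(l, l)`.
    refine ⟨G.restrict {l}, G.restrict {l}, ⟨h, rfl, rfl⟩, ⟨h, rfl, rfl⟩, restrict_subset _ _,
      restrict_subset _ _, ?_⟩
    rintro v ⟨_, rfl, _⟩ w ⟨_, rfl, _⟩
    exact h
  | app_sum t f =>
    constructor
    · rintro ⟨G₁, G₂, h₁, ⟨i, h₂⟩, k⟩
      exact ⟨i, G₁, G₂, h₁, h₂, k⟩
    · rintro ⟨i, G₁, G₂, h₁, h₂, k⟩
      exact ⟨G₁, G₂, h₁, ⟨i, h₂⟩, k⟩
  | sum_app f t =>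
    constructor
    · rintro ⟨G₁, G₂, ⟨i, h₁⟩, h₂, k⟩
      exact ⟨i, G₁, G₂, h₁, h₂, k⟩
    · rintro ⟨i, G₁, G₂, h₁, h₂, k⟩
      exact ⟨G₁, G₂, ⟨i, h₁⟩, h₂, k⟩
  | prod_distrib c d e _ hd _ hl =>
    rw [forces_mul]
    refine ⟨fun h => ⟨h.of_app_left, (forces_app_assoc.2 h).of_app_right⟩, ?_⟩
    rintro ⟨⟨G₁, G₂, h₁, h₂, k₁, k₂, k⟩, G₂', G₃, h₂', h₃, k₂', k₃, k'⟩
    -- The two witnesses for `d` are intersected. As a label occurs in `d`, the intersection has a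
    -- vertex `x`, and edges from `c` to `e` arise by transitivity through `x`.
    have hi : (inter fun b : Bool => cond b G₂ G₂').Forces d :=
      forces_inter hd _ (by rintro (_ | _) <;> assumption)
    obtain ⟨x, hx⟩ := hi.verts_nonempty hd hl
    refine ⟨_, G₃, h₁.app_restrict hi k₁ (fun e he => k₂ (he true))
      (fun v hv w hw => k v hv w (hw true)), h₃, restrict_subset _ _, k₃, ?_⟩
    rintro v ⟨_, hv | hv, _⟩ w hw
    exacts [G.trans (k v hv x (hx true)) (k' x (hx false) w hw), k' v (hv false) w hw]
  | app_prod c f hc _ =>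
    constructor
    · rintro ⟨G₁, G₂, h₁, h₂, k⟩ i
      exact ⟨G₁, G₂, h₁, h₂ i, k⟩
    · intro h
      choose G₁ G₂ h₁ h₂ k₁ k₂ k using h
      -- A vertex of the second graph comes from some `G₂ i`, and the intersection lies in the
      -- matching `G₁ i`, so the joining edge is present.
      refine ⟨inter G₁, G.restrict (⋃ i, (G₂ i).verts), forces_inter hc _ h₁,
        fun i => (h₂ i).mono (subset_restrict (k₂ i) (Set.subset_iUnion_of_subset i subset_rfl)),
        fun e he => k₁ (Classical.arbitrary _) (he _), restrict_subset _ _, ?_⟩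
      rintro v hv w ⟨_, hw, _⟩
      obtain ⟨i, hi⟩ := Set.mem_iUnion.1 hw
      exact k i v (hv i) w hi
  | prod_app f c _ hc =>
    constructor
    · rintro ⟨G₁, G₂, h₁, h₂, k⟩ i
      exact ⟨G₁, G₂, h₁ i, h₂, k⟩
    · intro h
      choose G₁ G₂ h₁ h₂ k₁ k₂ k using h
      refine ⟨G.restrict (⋃ i, (G₁ i).verts), inter G₂,
        fun i => (h₁ i).mono (subset_restrict (k₁ i) (Set.subset_iUnion_of_subset i subset_rfl)),
        forces_inter hc _ h₂,
        restrict_subset _ _, fun e he => k₂ (Classical.arbitrary _) (he _), ?_⟩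
      rintro v ⟨_, hv, _⟩ w hw
      obtain ⟨i, hi⟩ := Set.mem_iUnion.1 hv
      exact k i v hi w (hw i)

theorem Forces.of_le {t s : Term L} (h : t ≤ s) {G : CGraph L} (hG : G.Forces t) :
    G.Forces s := by
  change Term.Le t s at h
  induction h generalizing G with
  | refl => exact hG
  | trans _ _ ih₁ ih₂ => exact ih₂ (ih₁ hG)
  | prod_le f i => exact hG i
  | le_prod f t _ ih => exact fun i => ih i hG
  | le_sum f i => exact ⟨i, hG⟩
  | sum_le f t _ ih => obtain ⟨i, hi⟩ := hG; exact ih i hi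
  | distrib f => choose g hg using hG; exact ⟨g, hg⟩
  | app_mono _ _ ih₁ ih₂ =>
    obtain ⟨G₁, G₂, h₁, h₂, k⟩ := hG
    exact ⟨G₁, G₂, ih₁ h₁, ih₂ h₂, k⟩
  | law h => exact (forces_iff_of_law h G).1 hG
  | law_symm h => exact (forces_iff_of_law h G).2 hG

end CGraph

/-! ### Every term is the sum of the graphs that force it -/

namespace Term

variable {L : Type u}

theorem app_le_left (t s : Term L) : app t s ≤ t :=
  (Le.app_mono (Le.law (Law.one_app t)) (Le.refl s)).trans
    ((Le.law (Law.absorb_mul t one s)).trans (mul_le_left _ _))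

theorem app_le_right (t s : Term L) : app t s ≤ s :=
  (Le.law (Law.app_one (app t s))).trans
    ((Le.law (Law.absorb_mul s t one)).trans (mul_le_left _ _))

theorem app_mono {t t' s s' : Term L} (h : t ≤ t') (k : s ≤ s') : app t s ≤ app t' s' :=
  Le.app_mono h k

theorem sumFree_edge (v w : L) : SumFree (app (label v) (label w)) := ⟨trivial, trivial⟩

/-- The graph of all edges above a term. -/
def graph (t : Term L) : CGraph L where
  edges := {e | t ≤ app (label e.1) (label e.2)}
  refl_left h := (le_trans h (app_le_left _ _)).trans (Le.law_symm (Law.idem _))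
  refl_right h := (le_trans h (app_le_right _ _)).trans (Le.law_symm (Law.idem _))
  -- Product distributivity turns `(v · w) * (w · z)` into `v · w · z`, which is below `v · z`.
  trans h k := (le_mul h k).trans
    ((Le.law_symm (Law.prod_distrib (label _) (label _) (label _)
      trivial trivial trivial trivial)).trans
      (app_mono (app_le_left _ _) le_rfl))

end Term

namespace CGraph

variable {L : Type u}

/-- The product of all edges of a causal graph, as a term. -/
def term (G : CGraph L) : Term L :=
  Term.prod fun e : G.edges => Term.app (Term.label e.1.1) (Term.label e.1.2)

theorem term_le_edge {G : CGraph L} {v w : L} (h : (v, w) ∈ G.edges) :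
    G.term ≤ Term.app (.label v) (.label w) :=
  Term.Le.prod_le (fun e : G.edges => Term.app (Term.label e.1.1) (Term.label e.1.2)) ⟨(v, w), h⟩

theorem le_term {G : CGraph L} {t : Term L}
    (h : ∀ v w, (v, w) ∈ G.edges → t ≤ Term.app (.label v) (.label w)) : t ≤ G.term :=
  Term.Le.le_prod _ _ fun e => h _ _ e.2

theorem le_term_graph (t : Term L) : t ≤ t.graph.term := le_term fun _ _ h => h

theorem term_anti {G H : CGraph L} (h : G.edges ⊆ H.edges) : H.term ≤ G.term :=
  le_term fun _ _ he => term_le_edge (h he)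

theorem forces_term (G : CGraph L) : G.Forces G.term := by
  rintro ⟨⟨v, w⟩, h⟩
  refine ⟨G.restrict {v}, G.restrict {w}, ⟨G.refl_left h, rfl, rfl⟩, ⟨G.refl_right h, rfl, rfl⟩,
    restrict_subset _ _, restrict_subset _ _, ?_⟩
  rintro v ⟨_, rfl, _⟩ w ⟨_, rfl, _⟩
  exact h

/-- Product distributivity glues the path `v, w, v', w'` from its three edges, at the shared
vertices `w` and then `v'`. -/
theorem term_le_app_edge_edge {G : CGraph L} {v w v' w' : L} (h₁ : (v, w) ∈ G.edges)
    (h₂ : (v', w') ∈ G.edges) (h : (w, v') ∈ G.edges) :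
    G.term ≤ .app (.app (.label v) (.label w)) (.app (.label v') (.label w')) := by
  have h₃ : G.term ≤ .app (.app (.label v) (.label w)) (.label v') :=
    (Term.le_mul (term_le_edge h₁) (term_le_edge h)).trans
      (Term.Le.law_symm (Term.Law.prod_distrib _ _ _ trivial trivial trivial trivial))
  exact ((Term.le_mul h₃ (term_le_edge h₂)).trans (Term.Le.law_symm
    (Term.Law.prod_distrib _ _ _ (Term.sumFree_edge v w) trivial trivial trivial))).trans
      (Term.Le.law_symm (Term.Law.assoc _ _ _))

theorem term_le_app_term {G G₁ G₂ : CGraph L} (h₁ : G₁.edges ⊆ G.edges)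
    (h₂ : G₂.edges ⊆ G.edges) (h : ∀ v ∈ G₁.verts, ∀ w ∈ G₂.verts, (v, w) ∈ G.edges) :
    G.term ≤ .app G₁.term G₂.term := by
  -- Distributivity over products needs nonempty products; a graph without edges has value `1`, the
  -- unit of application.
  rcases isEmpty_or_nonempty G₁.edges with e₁ | e₁
  · refine (term_anti h₂).trans (le_trans (Term.Le.law (Term.Law.one_app _)) ?_)
    exact Term.app_mono (Term.Le.le_prod _ _ fun i => isEmptyElim i) le_rfl
  rcases isEmpty_or_nonempty G₂.edges with e₂ | e₂
  · refine (term_anti h₁).trans (le_trans (Term.Le.law (Term.Law.app_one _)) ?_)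
    exact Term.app_mono le_rfl (Term.Le.le_prod _ _ fun i => isEmptyElim i)
  refine le_trans ?_ (Term.Le.law_symm (Term.Law.prod_app _ _
    (fun _ => Term.sumFree_edge _ _) (fun _ => Term.sumFree_edge _ _)))
  refine Term.Le.le_prod _ _ fun i => ?_
  refine Term.Le.trans ?_ (Term.Le.law_symm (Term.Law.app_prod _ _
    (Term.sumFree_edge _ _) (fun _ => Term.sumFree_edge _ _)))
  refine Term.Le.le_prod _ _ fun j => ?_
  exact term_le_app_edge_edge (h₁ i.2) (h₂ j.2)
    (h _ (G₁.refl_right i.2) _ (G₂.refl_left j.2))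

theorem Forces.term_le {t : Term L} {G : CGraph L} (h : G.Forces t) : G.term ≤ t := by
  induction t generalizing G with
  | label l => exact (term_le_edge h).trans (Term.app_le_left _ _)
  | prod f ih => exact Term.Le.le_prod _ _ fun i => ih i (h i)
  | sum f ih => obtain ⟨i, hi⟩ := h; exact le_trans (ih i hi) (Term.Le.le_sum f i)
  | app t s iht ihs =>
    obtain ⟨G₁, G₂, h₁, h₂, k₁, k₂, k⟩ := h
    exact (term_le_app_term k₁ k₂ k).trans (Term.app_mono (iht h₁) (ihs h₂))

theorem term_le_iff {t : Term L} {G : CGraph L} : G.term ≤ t ↔ G.Forces t :=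
  ⟨fun h => G.forces_term.of_le h, Forces.term_le⟩

/-- The sum of a set of causal graphs, as a term. -/
def sumTerm (S : Set (CGraph L)) : Term L := .sum fun G : S => G.1.term

theorem le_sumTerm {S : Set (CGraph L)} {G : CGraph L} (h : G ∈ S) : G.term ≤ sumTerm S :=
  Term.Le.le_sum (fun G : S => G.1.term) ⟨G, h⟩

theorem le_sumTerm_of_graph {S : Set (CGraph L)} {t : Term L} (h : t.graph ∈ S) : t ≤ sumTerm S :=
  (le_term_graph t).trans (le_sumTerm h)

theorem le_sumTerm_forces (t : Term L) : t ≤ sumTerm {G | G.Forces t} := by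
  induction t with
  | label l => exact le_sumTerm_of_graph (Term.Le.law_symm (Term.Law.idem l))
  | prod f ih =>
    refine le_trans (Term.Le.le_prod _ _ fun i => le_trans (Term.Le.prod_le f i) (ih i)) ?_
    -- Complete distributivity picks one forcing graph `g i` per factor. The graph of all edges
    -- above their product contains each `g i`, so it forces every factor.
    refine le_trans (Term.Le.distrib _) (Term.Le.sum_le _ _ fun g => le_sumTerm_of_graph ?_)
    exact fun i => (g i).2.mono fun e he =>
      le_trans (Term.Le.prod_le (fun i => (g i).1.term) i) (term_le_edge he)
  | sum f ih =>
    refine Term.Le.sum_le _ _ fun i => le_trans (ih i) (Term.Le.sum_le _ _ fun G => ?_)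
    exact le_sumTerm ⟨i, G.2⟩
  | app t s iht ihs =>
    refine (Term.app_mono iht ihs).trans (le_trans (Term.Le.law (Term.Law.sum_app _ _)) ?_)
    refine Term.Le.sum_le _ _ fun G₁ => Term.Le.trans (Term.Le.law (Term.Law.app_sum _ _)) ?_
    refine Term.Le.sum_le _ _ fun G₂ => le_sumTerm_of_graph ?_
    refine ⟨G₁.1, G₂.1, G₁.2, G₂.2, fun e he => (Term.app_le_left _ _).trans (term_le_edge he),
      fun e he => (Term.app_le_right _ _).trans (term_le_edge he), fun v hv w hw => ?_⟩
    exact Term.app_mono ((term_le_edge hv).trans (Term.app_le_left _ _))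
      ((term_le_edge hw).trans (Term.app_le_left _ _))

end CGraph

/-! ### Values as sets of graphs -/

namespace Value

variable {L : Type u}

theorem value_le_mk {G : CGraph L} {t : Term L} : G.value ≤ mk t ↔ G.Forces t :=
  CGraph.term_le_iff

theorem le_iff_forall_value {x y : Value L} :
    x ≤ y ↔ ∀ G : CGraph L, G.value ≤ x → G.value ≤ y := by
  refine ⟨fun h G hG => hG.trans h, fun h => ?_⟩
  induction x using Quotient.inductionOn with | _ t =>
  exact (show mk t ≤ mk _ from CGraph.le_sumTerm_forces t).trans <| by
    induction y using Quotient.inductionOn with | _ s =>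
    exact Term.Le.sum_le _ _ fun G => h G.1 (value_le_mk.2 G.2)

theorem value_anti {G H : CGraph L} (h : G.edges ⊆ H.edges) : H.value ≤ G.value :=
  CGraph.term_anti h

theorem value_le_label {G : CGraph L} {l : L} : G.value ≤ label l ↔ (l, l) ∈ G.edges :=
  value_le_mk

theorem value_le_app {G : CGraph L} {x y : Value L} :
    G.value ≤ app x y ↔ ∃ G₁ G₂ : CGraph L, G₁.value ≤ x ∧ G₂.value ≤ y ∧
      G₁.edges ⊆ G.edges ∧ G₂.edges ⊆ G.edges ∧
        ∀ v ∈ G₁.verts, ∀ w ∈ G₂.verts, (v, w) ∈ G.edges := by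
  induction x using Quotient.inductionOn with | _ t =>
  induction y using Quotient.inductionOn with | _ s =>
  refine (value_le_mk (t := Term.app t s)).trans ?_
  refine exists₂_congr fun G₁ G₂ => ?_
  exact and_congr (value_le_mk (t := t)).symm (and_congr_left' (value_le_mk (t := s)).symm)

theorem app_mono {x x' y y' : Value L} (h : x ≤ x') (k : y ≤ y') : app x y ≤ app x' y' := by
  rw [le_iff_forall_value]
  intro G hG
  obtain ⟨G₁, G₂, h₁, h₂, l⟩ := value_le_app.1 hG
  exact value_le_app.2 ⟨G₁, G₂, h₁.trans h, h₂.trans k, l⟩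

theorem app_le_left (x y : Value L) : app x y ≤ x := by
  rw [le_iff_forall_value]
  intro G hG
  obtain ⟨G₁, G₂, h₁, h₂, l, _⟩ := value_le_app.1 hG
  exact (value_anti l).trans h₁

/-- The sum of a set of causal graphs. -/
def ofGraphs (S : Set (CGraph L)) : Value L := mk (CGraph.sumTerm S)

theorem value_le_ofGraphs {S : Set (CGraph L)} {G : CGraph L} :
    G.value ≤ ofGraphs S ↔ ∃ H ∈ S, G.value ≤ H.value := by
  refine (value_le_mk (t := CGraph.sumTerm S)).trans ⟨?_, ?_⟩
  · rintro ⟨⟨H, hH⟩, h⟩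
    exact ⟨H, hH, value_le_mk.2 h⟩
  · rintro ⟨H, hH, h⟩
    exact ⟨⟨H, hH⟩, value_le_mk.1 h⟩

/-- With `value_anti`, the order on graph values is reverse edge inclusion, so an edgewise operation
on graphs respects the order on their values. -/
theorem edges_subset_of_value_le {G H : CGraph L} (h : G.value ≤ H.value) :
    H.edges ⊆ G.edges := by
  rintro ⟨v, w⟩ he
  have h' : G.value ≤ app (label v) (label w) := h.trans (CGraph.term_le_edge he)
  obtain ⟨G₁, G₂, h₁, h₂, _, _, k⟩ := value_le_app.1 h'
  exact k v (value_le_label.1 h₁) w (value_le_label.1 h₂)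

theorem not_value_le_bot (G : CGraph L) : ¬ G.value ≤ ⊥ :=
  fun h => G.not_forces_zero (value_le_mk.1 h)

/-- The full graph has the least value of all graphs, so it lies below every value that has any
graph below it. -/
theorem ne_bot_iff {x : Value L} : x ≠ ⊥ ↔ CGraph.full.value ≤ x := by
  refine ⟨fun h => ?_, fun h e => not_value_le_bot _ (e ▸ h)⟩
  by_contra hf
  refine h (eq_bot_iff.2 (le_iff_forall_value.2 fun G hG => ?_))
  exact (hf ((value_anti (Set.subset_univ _)).trans hG)).elim

theorem app_ne_bot {x y : Value L} (hx : x ≠ ⊥) (hy : y ≠ ⊥) : app x y ≠ ⊥ := by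
  rw [ne_bot_iff] at *
  exact value_le_app.2 ⟨_, _, hx, hy, subset_rfl, subset_rfl, fun _ _ _ _ => trivial⟩

theorem label_ne_bot (l : L) : label l ≠ ⊥ :=
  ne_bot_iff.2 (value_le_label.2 trivial)

end Value

/-! ### Least models -/

variable {L : Type u} {At : Set L}

/-- A positive program whose rules have one head atom. -/
def Program.IsPositive (Q : Program At) : Prop :=
  ∀ R ∈ Q, (∃ A, R.headPos = {A}) ∧ R.bodyNeg = ∅

theorem Program.IsNormal.reduct {P : Program At} (hP : P.IsNormal) (I : Interp At) :
    (P.reduct I).IsPositive := by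
  rintro _ ⟨R, hR, _, _, rfl⟩
  exact ⟨(hP R hR).1, rfl⟩

namespace Interp

theorem std_eq_iff {I J : Interp At} : I.std = J.std ↔ I.atoms = J.atoms := by
  classical
  have h : (⊤ : Value L) ≠ ⊥ := Value.ne_bot_iff.2 le_top
  constructor
  · intro e
    ext A
    have := congrFun e A
    by_cases h₁ : I A = ⊥ <;> by_cases h₂ : J A = ⊥ <;>
      simp_all [std, atoms, eq_comm]
  · intro e
    ext A : 1
    have h : I A = ⊥ ↔ J A = ⊥ := not_iff_not.1 (Set.ext_iff.1 e A)
    simp only [std, h]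

theorem reduct_congr (P : Program At) {I J : Interp At} (h : I.std = J.std) :
    P.reduct I = P.reduct J := by
  have h' (B : At) : I B = ⊥ ↔ J B = ⊥ := not_iff_not.1 (Set.ext_iff.1 (std_eq_iff.1 h) B)
  simp only [Program.reduct, h', ne_eq]

theorem body_of_bodyNeg_eq {R : Rule At} (h : R.bodyNeg = ∅) (I : Interp At) :
    I.body R = R.bodyPos.inf I := by
  simp [body, h]

theorem value_le_body {R : Rule At} (h : R.bodyNeg = ∅) {I : Interp At} {G : CGraph L} :
    G.value ≤ I.body R ↔ ∀ B ∈ R.bodyPos, G.value ≤ I B := by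
  rw [body_of_bodyNeg_eq h, Finset.le_inf_iff]

theorem body_mono {R : Rule At} (h : R.bodyNeg = ∅) {I J : Interp At} (hIJ : I ≤ J) :
    I.body R ≤ J.body R := by
  rw [Value.le_iff_forall_value]
  intro G
  rw [value_le_body h, value_le_body h]
  exact fun hG B hB => (hG B hB).trans (hIJ B)

/-- `C` may be too large to index a product of terms, but the graphs over `L` are few enough: the
infimum is the sum of the graphs common to all members. -/
theorem exists_isGLB (C : Set (Interp At)) : ∃ I, IsGLB C I := by
  refine ⟨fun A => Value.ofGraphs {G | ∀ K ∈ C, G.value ≤ K A}, ?_, ?_⟩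
  · intro K hK A
    refine Value.le_iff_forall_value.2 fun G hG => ?_
    obtain ⟨H, hH, h⟩ := Value.value_le_ofGraphs.1 hG
    exact h.trans (hH K hK)
  · intro J hJ A
    refine Value.le_iff_forall_value.2 fun G hG => Value.value_le_ofGraphs.2 ⟨G, ?_, le_rfl⟩
    exact fun K hK => hG.trans (hJ hK A)

theorem satisfies_iff {R : Rule At} {A : At} (h : R.headPos = {A}) {I : Interp At} :
    I.Satisfies R ↔
      Value.app (Value.app (I.body R) (Value.label R.label)) (Value.label (A : L)) ≤ I A := by
  simp [Satisfies, h]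

theorem cjSatisfies_iff {R : Rule At} {A : At} (h : R.headPos = {A}) {I : Interp At} :
    I.CJSatisfies R ↔ Value.app (I.body R) (Value.label R.label) ≤ I A := by
  simp [CJSatisfies, h]

/-- A value below the values of `A` in all members of `C` is below the infimum of `C` at `A`. -/
theorem le_isGLB_apply {C : Set (Interp At)} {I : Interp At} (hI : IsGLB C I) {A : At}
    {x : Value L} (h : ∀ K ∈ C, x ≤ K A) : x ≤ I A := by
  classical
  -- The interpretation that is `x` at `A` and `⊥` elsewhere is a lower bound of `C`.
  have := hI.2 (show Function.update ⊥ A x ∈ lowerBounds C from fun K hK B => by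
    rcases eq_or_ne B A with rfl | hB
    · simpa using h K hK
    · simp [Function.update_of_ne hB]) A
  simpa using this

theorem exists_isLeast_isModel {Q : Program At} (hQ : Q.IsPositive) :
    ∃ I, IsLeast {K : Interp At | K.IsModel Q} I := by
  obtain ⟨I, hI⟩ := exists_isGLB {K : Interp At | K.IsModel Q}
  refine ⟨I, fun R hR => ?_, hI.1⟩
  obtain ⟨⟨A, hA⟩, hn⟩ := hQ R hR
  rw [satisfies_iff hA]
  refine le_isGLB_apply hI fun K hK => le_trans ?_ ((satisfies_iff hA).1 (hK R hR))
  exact Value.app_mono (Value.app_mono (body_mono hn (hI.1 hK)) le_rfl) le_rfl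

theorem exists_isLeast_isCJModel {Q : Program At} (hQ : Q.IsPositive) :
    ∃ I, IsLeast {K : Interp At | K.IsCJModel Q} I := by
  obtain ⟨I, hI⟩ := exists_isGLB {K : Interp At | K.IsCJModel Q}
  refine ⟨I, fun R hR => ?_, hI.1⟩
  obtain ⟨⟨A, hA⟩, hn⟩ := hQ R hR
  rw [cjSatisfies_iff hA]
  refine le_isGLB_apply hI fun K hK => le_trans ?_ ((cjSatisfies_iff hA).1 (hK R hR))
  exact Value.app_mono (body_mono hn (hI.1 hK)) le_rfl

/-! ### Two-valued collapse and stability as leastness -/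

theorem atoms_mono {I J : Interp At} (h : I ≤ J) : I.atoms ⊆ J.atoms :=
  fun A hA e => hA (le_bot_iff.1 (e ▸ h A))

theorem body_ne_bot {R : Rule At} (h : R.bodyNeg = ∅) {I : Interp At} :
    I.body R ≠ ⊥ ↔ ∀ B ∈ R.bodyPos, B ∈ I.atoms := by
  rw [Value.ne_bot_iff, value_le_body h]
  simp only [← Value.ne_bot_iff]
  rfl

theorem atoms_std (I : Interp At) : I.std.atoms = I.atoms := by
  have h : (⊤ : Value L) ≠ ⊥ := Value.ne_bot_iff.2 le_top
  ext A
  by_cases hA : I A = ⊥ <;> simp [std, atoms, hA, h]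

theorem std_apply {I : Interp At} {A : At} (h : A ∈ I.atoms) : I.std A = ⊤ := if_neg h

/-- A rule whose body is `⊥` is satisfied trivially. Otherwise its CJ-consequence is nonzero, so the
head atom is true in `J` and has value `⊤` after the collapse. -/
theorem IsCJModel.std_isModel {Q : Program At} (hQ : Q.IsPositive) {J : Interp At}
    (hJ : J.IsCJModel Q) : J.std.IsModel Q := by
  intro R hR
  obtain ⟨⟨A, hA⟩, hn⟩ := hQ R hR
  rw [satisfies_iff hA]
  by_cases hb : J.std.body R = ⊥
  · exact ((Value.app_le_left _ _).trans (Value.app_le_left _ _)).trans (hb.le.trans bot_le)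
  have hb' : J.body R ≠ ⊥ := by
    rw [← ne_eq, body_ne_bot hn, atoms_std] at hb
    exact (body_ne_bot hn).2 hb
  rw [std_apply (I := J) (A := A) fun e => Value.app_ne_bot hb' (Value.label_ne_bot R.label)
    (le_bot_iff.1 (e ▸ (cjSatisfies_iff hA).1 (hJ R hR)))]
  exact le_top

theorem IsModel.std_isCJModel {Q : Program At} (hQ : Q.IsPositive) {I : Interp At}
    (hI : I.IsModel Q) : I.std.IsCJModel Q := by
  intro R hR
  obtain ⟨⟨A, hA⟩, hn⟩ := hQ R hR
  rw [cjSatisfies_iff hA]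
  by_cases hb : I.std.body R = ⊥
  · exact (Value.app_le_left _ _).trans (hb.le.trans bot_le)
  have hb' : I.body R ≠ ⊥ := by
    rw [← ne_eq, body_ne_bot hn, atoms_std] at hb
    exact (body_ne_bot hn).2 hb
  rw [std_apply (I := I) (A := A) fun e => Value.app_ne_bot
    (Value.app_ne_bot hb' (Value.label_ne_bot R.label)) (Value.label_ne_bot _)
    (le_bot_iff.1 (e ▸ (satisfies_iff hA).1 (hI R hR)))]
  exact le_top

theorem std_eq_of_isLeast {Q : Program At} (hQ : Q.IsPositive) {I J : Interp At}
    (hI : IsLeast {K : Interp At | K.IsModel Q} I)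
    (hJ : IsLeast {K : Interp At | K.IsCJModel Q} J) : I.std = J.std := by
  refine std_eq_iff.2 (Set.Subset.antisymm ?_ ?_)
  · exact (atoms_mono (hI.2 (IsCJModel.std_isModel hQ hJ.1))).trans (atoms_std J).subset
  · exact (atoms_mono (hJ.2 (IsModel.std_isCJModel hQ hI.1))).trans (atoms_std I).subset

theorem _root_.CausalLP.isCausalStable_iff {P : Program At} (hP : P.IsNormal) {I : Interp At} :
    IsCausalStable P I ↔ IsLeast {K : Interp At | K.IsModel (P.reduct I)} I := by
  constructor
  · rintro ⟨_, h⟩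
    obtain ⟨M, hM⟩ := exists_isLeast_isModel (hP.reduct I)
    by_cases e : M = I
    · exact e ▸ hM
    · exact (h ⟨M, hM.1, Or.inl (hM.2 ‹_›), e⟩).elim
  · refine fun h => ⟨h.1, ?_⟩
    rintro ⟨J, hJ, hw | hw, hne⟩
    · exact hne (le_antisymm hw (h.2 hJ))
    -- The true atoms of a least model are true in every model, so no model has strictly fewer.
    · exact hw.2 (atoms_mono (h.2 hJ))

/-! ### Deleting labels that label no rule -/

theorem deleteLabels_mono (D : Set L) {G H : CGraph L} (h : G.edges ⊆ H.edges) :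
    (G.deleteLabels D).edges ⊆ (H.deleteLabels D).edges :=
  fun _ he => ⟨h he.1, he.2⟩

/-- The interpretation given by the graphs that belong to `J` after deleting labels. -/
def undelete (D : Set L) (J : Interp At) : Interp At :=
  fun A => Value.ofGraphs {G | (G.deleteLabels D).value ≤ J A}

theorem value_le_undelete {D : Set L} {J : Interp At} {A : At} {G : CGraph L} :
    G.value ≤ J.undelete D A ↔ (G.deleteLabels D).value ≤ J A := by
  refine Value.value_le_ofGraphs.trans ⟨?_, fun h => ⟨G, h, le_rfl⟩⟩
  rintro ⟨H, hH, h⟩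
  exact (Value.value_anti (deleteLabels_mono D (Value.edges_subset_of_value_le h))).trans hH

theorem IsCJModel.undelete_isModel {Q : Program At} (hQ : Q.IsPositive) {J : Interp At}
    (hJ : J.IsCJModel Q) {D : Set L} (hD : ∀ R ∈ Q, R.label ∉ D) :
    (J.undelete D).IsModel Q := by
  intro R hR
  obtain ⟨⟨A, hA⟩, hn⟩ := hQ R hR
  rw [satisfies_iff hA]
  -- The appended head atom only shrinks the value, so it can be dropped.
  refine (Value.app_le_left _ _).trans (Value.le_iff_forall_value.2 fun G hG => ?_)
  obtain ⟨G₁, G₂, h₁, h₂, k₁, k₂, k⟩ := Value.value_le_app.1 hG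
  rw [value_le_undelete]
  refine le_trans ?_ ((cjSatisfies_iff hA).1 (hJ R hR))
  have hr := Value.value_le_label.1 h₂
  -- Deletion acts on the two witnesses separately: a joining edge survives because both its
  -- endpoints do, and the rule label survives because it is not in `D`.
  refine Value.value_le_app.2 ⟨G₁.deleteLabels D, G₂.deleteLabels D, ?_, ?_,
    deleteLabels_mono D k₁, deleteLabels_mono D k₂, ?_⟩
  · rw [value_le_body hn] at h₁ ⊢
    exact fun B hB => value_le_undelete.1 (h₁ B hB)
  · exact Value.value_le_label.2 ⟨hr, hD R hR, hD R hR⟩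
  · exact fun v hv w hw => ⟨k v hv.1 w hw.1, hv.2.1, hw.2.1⟩

theorem deleteLabels_value_le {P : Program At} (hP : P.IsNormal) {I J : Interp At}
    (hI : IsCausalStable P I) (hJ : IsCJStable P J) (h : I.std = J.std) {D : Set L}
    (hD : ∀ R ∈ P, R.label ∉ D) {A : At} {G : CGraph L} (hG : G.value ≤ I A) :
    (G.deleteLabels D).value ≤ J A := by
  refine value_le_undelete.1 (hG.trans (((isCausalStable_iff hP).1 hI).2 ?_ A))
  rw [reduct_congr P h]
  refine IsCJModel.undelete_isModel (hP.reduct J) hJ.1 ?_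
  rintro _ ⟨R, hR, _, _, rfl⟩
  exact hD R hR

end Interp

/-! ### Correspondence of the stable models -/

theorem IsCausalStable.existsUnique_isCJStable {P : Program At} (hP : P.IsNormal)
    {I : Interp At} (hI : IsCausalStable P I) :
    ∃! J : Interp At, IsCJStable P J ∧ I.std = J.std := by
  obtain ⟨J, hJ⟩ := Interp.exists_isLeast_isCJModel (hP.reduct I)
  have h := Interp.std_eq_of_isLeast (hP.reduct I) ((isCausalStable_iff hP).1 hI) hJ
  refine ⟨J, ⟨by rwa [IsCJStable, ← Interp.reduct_congr P h], h⟩, ?_⟩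
  rintro K ⟨hK, e⟩
  -- Equal true atoms give equal reducts, so both candidates are least for the same program.
  rw [IsCJStable, ← Interp.reduct_congr P e] at hK
  exact hK.unique hJ

theorem IsCJStable.existsUnique_isCausalStable {P : Program At} (hP : P.IsNormal)
    {J : Interp At} (hJ : IsCJStable P J) :
    ∃! I : Interp At, IsCausalStable P I ∧ I.std = J.std := by
  obtain ⟨I, hI⟩ := Interp.exists_isLeast_isModel (hP.reduct J)
  have h := Interp.std_eq_of_isLeast (hP.reduct J) hI hJ
  refine ⟨I, ⟨by rwa [isCausalStable_iff hP, Interp.reduct_congr P h], h⟩, ?_⟩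
  rintro K ⟨hK, e⟩
  rw [isCausalStable_iff hP, Interp.reduct_congr P e] at hK
  exact hK.unique hI

end CausalLP

theorem mainTheorem4 {L : Type u} (At : Set L) (P : CausalLP.Program At) (hP : P.IsNormal) :
    (∀ I : CausalLP.Interp At, CausalLP.IsCausalStable P I →
      ∃! J : CausalLP.Interp At, CausalLP.IsCJStable P J ∧ I.std = J.std) ∧
    (∀ J : CausalLP.Interp At, CausalLP.IsCJStable P J →
      ∃! I : CausalLP.Interp At, CausalLP.IsCausalStable P I ∧ I.std = J.std) ∧
    (∀ I J : CausalLP.Interp At, CausalLP.IsCausalStable P I → CausalLP.IsCJStable P J →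
      I.std = J.std →
      -- if no atom is used as a rule label, all edges with an atom label are deleted
      ((∀ R ∈ P, R.label ∉ At) →
        ∀ (A : At) (G : CausalLP.CGraph L), G.value ≤ I A → (G.deleteLabels At).value ≤ J A) ∧
      -- in general, all edges with an atom label that does not label a rule of `P` are deleted
      (∀ (A : At) (G : CausalLP.CGraph L), G.value ≤ I A →
        (G.deleteLabels {l | l ∈ At ∧ ∀ R ∈ P, R.label ≠ l}).value ≤ J A)) := by
  refine ⟨fun I hI => hI.existsUnique_isCJStable hP, fun J hJ => hJ.existsUnique_isCausalStable hP,
    fun I J hI hJ h => ⟨fun hD A G hG => ?_, fun A G hG => ?_⟩⟩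
  · exact CausalLP.Interp.deleteLabels_value_le hP hI hJ h hD hG
  · exact CausalLP.Interp.deleteLabels_value_le hP hI hJ h (fun R hR hl => hl.2 R hR rfl) hG
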